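/- Let $\mathbb D$ be the open unit disc and, for $f$ holomorphic in $\mathbb D$, let $\hat f(k)$ denote its $k$-th Taylor coefficient at $0$. For $p\in[1,\infty]$ and $\alpha\le 0$ let $l_a^p(\alpha)$ be the space of all $f$ holomorphic in $\mathbb D$ with $\|f\|_{l_a^p(\alpha)}=\bigl(\sum_{k\ge 0}|\hat f(k)|^p(k+1)^{p\alpha}\bigr)^{1/p}<\infty$ (for $p=\infty$: $\sup_{k\ge 0}|\hat f(k)|(k+1)^{\alpha}<\infty$), and let $H^\infty$ be the space of bounded holomorphic functions in $\mathbb D$ with the supremum norm. For a finite family $\sigma=\{\lambda_1,\dots,\lambda_m\}$ of points of $\mathbb D$, repetitions allowed, put $B_\sigma(z)=\prod_{j=1}^m\frac{\lambda_j-z}{1-\overline{\lambda_j}z}$ and $$c(\sigma,X,H^\infty)=\sup_{f\in X,\ \|f\|_X\le 1}\ \inf\{\|g\|_{H^\infty}:\ g\in H^\infty,\ f-g=B_\sigma h\text{ for some } h \text{ holomorphic in } \mathbb D\},$$ i.e. $g$ interpolates $f$ on $\sigma$, counted with multiplicities. For $n\ge 1$ and $r\in[0,1)$ let $C_{n,r}(X,H^\infty)$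 be the supremum of $c(\sigma,X,H^\infty)$ over all such $\sigma$ with at most $n$ points (counted with multiplicities), all of modulus at most $r$. Theorem D. Let $p\in[2,\infty]$ and $\alpha\le 0$. There are constants $A',B'>0$, depending only on $\alpha$ and $p$, such that for all integers $n\ge 1$ and all $r\in[0,1)$, $$B'\,n^{1-\alpha-\frac1p}\ \le\ C_{n,r}\bigl(l_a^p(\alpha),H^\infty\bigr)\ \le\ A'\Bigl(\frac{n}{1-r}\Bigr)^{\frac32-\alpha-\frac2p},$$ where $1/\infty=0$. -/

import Mathlib

open scoped ENNReal ComplexConjugate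

namespace ConstrainedInterpolation

noncomputable section

/-- The open unit disc. -/
def disc : Set ℂ := Metric.ball 0 1

/-- The `k`-th Taylor coefficient at the origin of a function holomorphic in the disc. -/
def taylorCoeff (f : ℂ → ℂ) (k : ℕ) : ℂ := iteratedDeriv k f 0 / (k.factorial : ℂ)

/-- The (extended) norm of `l_a^p(α)`: the `ℓ^p`-norm of the sequence `|f̂(k)| (k + 1) ^ α`.
A function holomorphic in the disc belongs to `l_a^p(α)` exactly when this is finite. -/
def lapNorm (p : ℝ≥0∞) (α : ℝ) (f : ℂ → ℂ) : ℝ≥0∞ :=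
  if p = ∞ then ⨆ k : ℕ, ENNReal.ofReal (‖taylorCoeff f k‖ * ((k : ℝ) + 1) ^ α)
  else (∑' k : ℕ, ENNReal.ofReal (‖taylorCoeff f k‖ ^ p.toReal * ((k : ℝ) + 1) ^ (p.toReal * α)))
    ^ (1 / p.toReal)

/-- The (extended) norm of `H^∞`. -/
def hInftyNorm (f : ℂ → ℂ) : ℝ≥0∞ := ⨆ z ∈ disc, ENNReal.ofReal ‖f z‖

/-- The Blaschke factor `b_μ`. -/
def blaschkeFactor (μ z : ℂ) : ℂ := (μ - z) / (1 - conj μ * z)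

/-- The finite Blaschke product `B_σ`, with zeros repeated according to multiplicity. -/
def blaschke (σ : Multiset ℂ) (z : ℂ) : ℂ := (σ.map fun μ => blaschkeFactor μ z).prod

/-- `f` and `g` have the same trace on `σ`, counted with multiplicities: `f - g` is the product of
`B_σ` and a function holomorphic in the disc. -/
def SameTrace (σ : Multiset ℂ) (f g : ℂ → ℂ) : Prop :=
  ∃ h : ℂ → ℂ, DifferentiableOn ℂ h disc ∧ ∀ z ∈ disc, f z - g z = blaschke σ z * h z

/-- The interpolation constant `c(σ, X, Y)` for two spaces `X`, `Y` of functions holomorphic in the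
disc, given by their extended norms (infinite exactly off the space). -/
def interpConst (σ : Multiset ℂ) (normX normY : (ℂ → ℂ) → ℝ≥0∞) : ℝ≥0∞ :=
  ⨆ (f : ℂ → ℂ) (_ : DifferentiableOn ℂ f disc ∧ normX f ≤ 1),
    ⨅ (g : ℂ → ℂ) (_ : DifferentiableOn ℂ g disc ∧ SameTrace σ f g), normY g

/-- `C_{n,r}(X, Y)`: the supremum of `c(σ, X, Y)` over all `σ` with at most `n` points, counted with
multiplicities, in the closed disc of radius `r`. -/
def worstInterpConst (n : ℕ) (r : ℝ) (normX normY : (ℂ → ℂ) → ℝ≥0∞) : ℝ≥0∞ :=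
  ⨆ (σ : Multiset ℂ) (_ : σ.card ≤ n ∧ ∀ μ ∈ σ, ‖μ‖ ≤ r), interpConst σ normX normY

end

end ConstrainedInterpolation

/-! Write `t = 1/p`. The upper bound is proved with the smaller exponent `1 - α - t`. Since `p ≥ 2`
gives `t ≤ 1/2`, this is at most `3/2 - α - 2t`, and `n / (1 - r) ≥ 1`, so the stated bound follows.

Upper bound: interpolate by the Hermite formula, the Cauchy integral of `f(z)/B(z) · (B(z) -
B(ζ))/(z - ζ)` over `|z| = 1 - δ` with `δ = (1 - r)/(8n)`. There `|B| ≥ 1/2`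
(`half_le_norm_blaschke`), so for `|ζ| = 1` the integrand is at most `3 |f(z)| / |z - ζ|`. The mean
square of `f` is `O(δ^(-(1 - 2α - 2t)))` (`exists_circleAverage_norm_sq_le_of_lapNorm`), that of the
Cauchy kernel is at most `δ⁻¹`, and a weighted AM-GM inequality gives `O(δ^(-(1 - α - t)))`. The
maximum principle carries this bound into the disc.

Lower bound: take `σ` to be the origin with multiplicity `n`, so that `g` shares its first `n`
Taylor coefficients with `f`. The Fejér-type sum `∑ (n - k) ĝ(k)` over `k < n` is at most `2n` times
the norm of `g` (`norm_sum_coeff_le_of_sameTrace`), whereas for `f` with coefficients `n^(-t) (k +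
1)^(-α)` it is of order at least `n^(2 - α - t)`. -/

namespace ConstrainedInterpolation
open Complex Metric Filter Topology
open Real (circleAverage)

/-! ### Mean squares on circles -/

/-- **Parseval's inequality** for absolutely summable power series on the unit circle. -/
theorem circleAverage_norm_sq_le {a : ℕ → ℂ} {f : ℂ → ℂ} {S : ℝ} (ha : Summable fun k => ‖a k‖)
    (hf : ∀ z : ℂ, ‖z‖ = 1 → HasSum (fun k => a k * z ^ k) (f z))
    (hS : ∀ N : ℕ, ∑ k ∈ Finset.range N, ‖a k‖ ^ 2 ≤ S) :
    circleAverage (fun z => ‖f z‖ ^ 2) 0 1 ≤ S := by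
  have hpoly : ∀ N : ℕ,
      circleAverage (fun z => ‖∑ k ∈ Finset.range N, a k * z ^ k‖ ^ 2) 0 1 ≤ S := by
    intro N
    set P : Polynomial ℂ := ∑ k ∈ Finset.range N, Polynomial.monomial k (a k) with hP
    have hev : ∀ z, P.eval z = ∑ k ∈ Finset.range N, a k * z ^ k := by
      intro z; simp [hP, Polynomial.eval_finsetSum]
    have hc : ∀ k, P.coeff k = if k ∈ Finset.range N then a k else 0 := by
      intro k; simp [hP, Polynomial.finsetSum_coeff, Polynomial.coeff_monomial]
    have h := Polynomial.sum_sq_norm_coeff_eq_circleAverage (p := P)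
    simp only [hev] at h
    rw [← h]
    refine le_trans ?_ (hS N)
    calc ∑ i ∈ P.support, ‖P.coeff i‖ ^ 2 ≤ ∑ i ∈ Finset.range N, ‖P.coeff i‖ ^ 2 := by
          apply Finset.sum_le_sum_of_subset_of_nonneg
          · intro i hi
            by_contra hn
            exact (Polynomial.mem_support_iff.1 hi) (by rw [hc, if_neg hn])
          · intros; positivity
      _ = _ := Finset.sum_congr rfl fun i hi => by rw [hc, if_pos hi]
  refine le_of_tendsto' (f := fun N : ℕ =>
    circleAverage (fun z => ‖∑ k ∈ Finset.range N, a k * z ^ k‖ ^ 2) 0 1) (x := atTop) ?_ hpoly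
  unfold Real.circleAverage
  refine Tendsto.const_smul ?_ _
  refine intervalIntegral.tendsto_integral_filter_of_dominated_convergence
    (fun _ => (∑' k, ‖a k‖) ^ 2) ?_ ?_ intervalIntegrable_const ?_
  · exact Eventually.of_forall fun N => Continuous.aestronglyMeasurable (by fun_prop)
  · refine Eventually.of_forall fun N => MeasureTheory.ae_of_all _ fun x _ => ?_
    rw [norm_pow, norm_norm]
    gcongr
    refine (norm_sum_le _ _).trans ?_
    refine le_trans (Finset.sum_le_sum fun k _ => ?_) (ha.sum_le_tsum _ fun _ _ => norm_nonneg _)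
    simp
  · refine MeasureTheory.ae_of_all _ fun x _ => ?_
    have := (hf (circleMap 0 1 x) (by simp)).tendsto_sum_nat
    exact (this.norm.pow 2)

/-- The mean square of the Cauchy kernel of a point of the unit circle on a smaller circle. -/
theorem circleAverage_norm_sq_inv_sub_le {ρ : ℝ} (h0 : 0 ≤ ρ) (h1 : ρ < 1) {ζ : ℂ} (hζ : ‖ζ‖ = 1) :
    circleAverage (fun z => ‖(z - ζ)⁻¹‖ ^ 2) 0 ρ ≤ (1 - ρ ^ 2)⁻¹ := by
  rw [Real.circleAverage_eq_circleAverage_zero_one]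
  simp only [add_zero]
  have hζ0 : ζ ≠ 0 := norm_ne_zero_iff.1 (by rw [hζ]; norm_num)
  have hnorm : ∀ k : ℕ, ‖-ζ⁻¹ * ((ρ : ℂ) / ζ) ^ k‖ = ρ ^ k := by
    intro k; simp [hζ, abs_of_nonneg h0]
  apply circleAverage_norm_sq_le (a := fun k => -ζ⁻¹ * ((ρ : ℂ) / ζ) ^ k)
  · simp only [hnorm]
    exact summable_geometric_of_lt_one h0 h1
  · intro z hz
    have h := (hasSum_geometric_of_norm_lt_one (ξ := (ρ : ℂ) * z / ζ)
      (by simpa [hζ, hz, abs_of_nonneg h0] using h1)).mul_left (-ζ⁻¹)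
    have hne : (ρ : ℂ) * z - ζ ≠ 0 := by
      intro h
      have := congrArg norm (sub_eq_zero.1 h)
      simp [hζ, hz, abs_of_nonneg h0] at this
      linarith
    convert! h using 1
    · ext k; ring
    · have : 1 - (ρ : ℂ) * z / ζ = -((ρ : ℂ) * z - ζ) / ζ := by field_simp; ring
      rw [this]; field_simp
  · intro N
    simp only [hnorm]
    have h2 : ρ ^ 2 < 1 := by nlinarith
    rw [← tsum_geometric_of_lt_one (by positivity) h2]
    refine le_trans (Finset.sum_le_sum fun k _ => ?_)
      ((summable_geometric_of_lt_one (by positivity) h2).sum_le_tsum _ fun _ _ => by positivity)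
    rw [← pow_mul, ← pow_mul, mul_comm]

theorem norm_circleIntegral_le_circleAverage {f : ℂ → ℂ} {R : ℝ} (hR : 0 ≤ R) :
    ‖(2 * Real.pi * I : ℂ)⁻¹ * ∮ z in C(0, R), f z‖ ≤ R * circleAverage (fun z => ‖f z‖) 0 R := by
  rw [norm_mul, circleAverage, circleIntegral]
  have h : ‖∫ θ in (0 : ℝ)..2 * Real.pi, deriv (circleMap 0 R) θ • f (circleMap 0 R θ)‖ ≤
      R * ∫ θ in (0 : ℝ)..2 * Real.pi, ‖f (circleMap 0 R θ)‖ := by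
    refine (intervalIntegral.norm_integral_le_integral_norm (by positivity)).trans_eq ?_
    rw [← intervalIntegral.integral_const_mul]
    congr 1 with θ
    simp [abs_of_nonneg hR]
  have h2 : ‖(2 * Real.pi * I : ℂ)⁻¹‖ = (2 * Real.pi)⁻¹ := by
    simp [abs_of_pos Real.pi_pos]
  rw [h2, smul_eq_mul, mul_left_comm]
  gcongr

/-! ### Taylor coefficients -/

/-- The Taylor series of a function holomorphic in the disc. -/
theorem hasSum_taylorCoeff {f : ℂ → ℂ} (hf : DifferentiableOn ℂ f disc) {z : ℂ} (hz : ‖z‖ < 1) :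
    HasSum (fun k => taylorCoeff f k * z ^ k) (f z) := by
  have h := Complex.hasSum_taylorSeries_on_ball (c := 0) (r := 1) (f := f) (z := z) hf (by simpa)
  convert! h using 1
  ext k
  simp [taylorCoeff, div_eq_mul_inv]; ring

theorem taylorCoeff_polynomial_eval (P : Polynomial ℂ) (k : ℕ) :
    taylorCoeff (fun z => P.eval z) k = P.coeff k := by
  have h : ∀ k, iteratedDeriv k (fun z => P.eval z) =
      fun z => (Polynomial.derivative^[k] P).eval z := by
    intro k
    induction k with
    | zero => simp
    | succ k ih =>
      ext z
      rw [iteratedDeriv_succ, ih, Function.iterate_succ_apply', Polynomial.deriv]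
  rw [taylorCoeff, h]
  beta_reduce
  rw [← Polynomial.coeff_zero_eq_eval_zero, Polynomial.coeff_iterate_derivative]
  simp [Nat.descFactorial_self]
  field_simp [Nat.factorial_ne_zero]

/-! ### Blaschke products -/

theorem one_sub_conj_mul_ne_zero {μ z : ℂ} (hμ : ‖μ‖ < 1) (hz : ‖z‖ ≤ 1) : 1 - conj μ * z ≠ 0 := by
  intro h
  have h1 : ‖conj μ * z‖ = 1 := by rw [← sub_eq_zero.1 h]; simp
  rw [norm_mul, RCLike.norm_conj] at h1
  nlinarith [norm_nonneg μ, norm_nonneg z]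

theorem differentiableAt_blaschkeFactor {μ z : ℂ} (hμ : ‖μ‖ < 1) (hz : ‖z‖ ≤ 1) :
    DifferentiableAt ℂ (blaschkeFactor μ) z := by
  unfold blaschkeFactor
  exact DifferentiableAt.div (by fun_prop) (by fun_prop) (one_sub_conj_mul_ne_zero hμ hz)

theorem blaschke_zero : blaschke 0 = fun _ => 1 := by
  ext z; simp [blaschke]

theorem blaschke_cons (μ : ℂ) (σ : Multiset ℂ) :
    blaschke (μ ::ₘ σ) = fun z => blaschkeFactor μ z * blaschke σ z := by
  ext z; simp [blaschke]

theorem differentiableAt_blaschke {σ : Multiset ℂ} (hσ : ∀ μ ∈ σ, ‖μ‖ < 1) {z : ℂ}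
    (hz : ‖z‖ ≤ 1) : DifferentiableAt ℂ (blaschke σ) z := by
  induction σ using Multiset.induction with
  | empty => rw [blaschke_zero]; fun_prop
  | cons μ σ ih =>
    rw [blaschke_cons]
    exact (differentiableAt_blaschkeFactor (hσ μ (by simp)) hz).mul
      (ih fun ν hν => hσ ν (Multiset.mem_cons_of_mem hν))

theorem norm_sq_blaschkeFactor {μ z : ℂ} (h : 1 - conj μ * z ≠ 0) :
    ‖blaschkeFactor μ z‖ ^ 2 =
      1 - (1 - ‖μ‖ ^ 2) * (1 - ‖z‖ ^ 2) / ‖1 - conj μ * z‖ ^ 2 := by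
  have h0 : ‖1 - conj μ * z‖ ^ 2 ≠ 0 := by simpa using h
  rw [blaschkeFactor, norm_div, div_pow, one_sub_div h0]
  congr 1
  simp only [← Complex.normSq_eq_norm_sq, Complex.normSq_apply]
  simp
  ring

theorem norm_blaschkeFactor_eq_one {μ z : ℂ} (hμ : ‖μ‖ < 1) (hz : ‖z‖ = 1) :
    ‖blaschkeFactor μ z‖ = 1 := by
  have h := norm_sq_blaschkeFactor (one_sub_conj_mul_ne_zero hμ hz.le)
  rw [hz] at h
  exact (pow_eq_one_iff_of_nonneg (norm_nonneg _) two_ne_zero).1 (by simpa using h)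

theorem norm_blaschke_eq_one {σ : Multiset ℂ} (hσ : ∀ μ ∈ σ, ‖μ‖ < 1) {z : ℂ}
    (hz : ‖z‖ = 1) : ‖blaschke σ z‖ = 1 := by
  induction σ using Multiset.induction with
  | empty => simp [blaschke_zero]
  | cons μ σ ih =>
    rw [blaschke_cons, norm_mul, norm_blaschkeFactor_eq_one (hσ μ (by simp)) hz,
      ih fun ν hν => hσ ν (Multiset.mem_cons_of_mem hν), one_mul]

theorem blaschke_ne_zero {σ : Multiset ℂ} (hσ : ∀ μ ∈ σ, ‖μ‖ < 1) {z : ℂ} (hz : ‖z‖ ≤ 1)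
    (hz' : z ∉ σ) : blaschke σ z ≠ 0 := by
  induction σ using Multiset.induction with
  | empty => simp [blaschke_zero]
  | cons μ σ ih =>
    rw [Multiset.mem_cons, not_or] at hz'
    rw [blaschke_cons]
    refine mul_ne_zero ?_ (ih (fun ν hν => hσ ν (Multiset.mem_cons_of_mem hν)) hz'.2)
    exact div_ne_zero (sub_ne_zero.2 (Ne.symm hz'.1))
      (one_sub_conj_mul_ne_zero (hσ μ (by simp)) hz)

/-- In the identity for `1 - |b_μ|²`, use `|1 - conj μ z| ≥ 1 - |μ|`, cancel one factor `1 - |μ|`,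
and bound `(1 + |μ|)(2 - δ)` by `4`. -/
theorem one_sub_le_norm_sq_blaschkeFactor {μ z : ℂ} {r δ : ℝ} (hr : r < 1) (hμ : ‖μ‖ ≤ r)
    (hz : ‖z‖ = 1 - δ) (hδ : 0 ≤ δ) (hδ1 : δ ≤ 1) :
    1 - 4 * δ / (1 - r) ≤ ‖blaschkeFactor μ z‖ ^ 2 := by
  have hμ1 : ‖μ‖ < 1 := hμ.trans_lt hr
  have hne := one_sub_conj_mul_ne_zero hμ1 (z := z) (by linarith)
  have hr0 : 0 < 1 - r := by linarith
  have hlow : 1 - ‖μ‖ ≤ ‖1 - conj μ * z‖ := by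
    have h1 := norm_sub_norm_le (1 : ℂ) (conj μ * z)
    rw [norm_one, norm_mul, RCLike.norm_conj, hz] at h1
    nlinarith [norm_nonneg μ]
  rw [norm_sq_blaschkeFactor hne, hz]
  have hμ0 : 0 < 1 - ‖μ‖ := by linarith
  have h2 : (1 - ‖μ‖ ^ 2) * (1 - (1 - δ) ^ 2) / ‖1 - conj μ * z‖ ^ 2 ≤
      (1 - ‖μ‖ ^ 2) * (1 - (1 - δ) ^ 2) / (1 - ‖μ‖) ^ 2 := by
    have : 0 ≤ (1 - ‖μ‖ ^ 2) * (1 - (1 - δ) ^ 2) := by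
      apply mul_nonneg <;> nlinarith [norm_nonneg μ]
    gcongr
  have h3 : (1 - ‖μ‖ ^ 2) * (1 - (1 - δ) ^ 2) / (1 - ‖μ‖) ^ 2 ≤ 4 * δ / (1 - ‖μ‖) := by
    have : (1 - ‖μ‖ ^ 2) * (1 - (1 - δ) ^ 2) / (1 - ‖μ‖) ^ 2 =
        (1 + ‖μ‖) * (δ * (2 - δ)) / (1 - ‖μ‖) := by
      field_simp; ring
    rw [this]
    refine div_le_div_of_nonneg_right ?_ hμ0.le
    have : (1 + ‖μ‖) * (2 - δ) ≤ 2 * 2 := by gcongr <;> linarith [norm_nonneg μ]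
    nlinarith
  have h4 : 4 * δ / (1 - ‖μ‖) ≤ 4 * δ / (1 - r) := by gcongr
  linarith

/-- A Blaschke product of at most `n` factors with zeros in the disc of radius `r` is bounded below
on circles at distance `(1 - r) / (8 n)` from the unit circle. -/
theorem half_le_norm_blaschke {σ : Multiset ℂ} {n : ℕ} {r : ℝ} (hn : 1 ≤ n) (hr : r < 1)
    (h0 : 0 ≤ r) (hc : σ.card ≤ n) (hσ : ∀ μ ∈ σ, ‖μ‖ ≤ r) {z : ℂ}
    (hz : ‖z‖ = 1 - (1 - r) / (8 * n)) : 1 / 2 ≤ ‖blaschke σ z‖ := by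
  have hn' : (1 : ℝ) ≤ n := by exact_mod_cast hn
  have hr0 : 0 < 1 - r := by linarith
  -- With `δ = (1 - r)/(8n)` the lower bound `1 - 4δ/(1 - r)` for each squared factor is exactly
  -- `q`, and Bernoulli's inequality gives `q ^ n ≥ 1/2`.
  set q : ℝ := 1 - 1 / (2 * n) with hq
  have hinv : 1 / (2 * (n : ℝ)) ≤ 1 / 2 := by
    apply one_div_le_one_div_of_le <;> linarith
  have hinv0 : 0 ≤ 1 / (2 * (n : ℝ)) := by positivity
  have hpow : q ^ σ.card ≤ ‖blaschke σ z‖ ^ 2 := by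
    clear hc
    induction σ using Multiset.induction with
    | empty => simp [blaschke_zero]
    | cons μ σ ih =>
      rw [blaschke_cons, norm_mul, mul_pow, Multiset.card_cons, pow_succ']
      have h1 : q ≤ ‖blaschkeFactor μ z‖ ^ 2 := by
        have := one_sub_le_norm_sq_blaschkeFactor hr (hσ μ (by simp)) hz (by positivity)
          ((div_le_one (by positivity)).2 (by linarith))
        convert! this using 1
        rw [hq]; field_simp; ring
      have h2 := ih fun ν hν => hσ ν (Multiset.mem_cons_of_mem hν)
      have : 0 ≤ q := by linarith
      gcongr
  have h1 : q ^ n ≤ q ^ σ.card := pow_le_pow_of_le_one (by linarith) (by linarith) hc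
  have h2 : 1 / 2 ≤ q ^ n := by
    have := one_add_mul_le_pow (a := -(1 / (2 * (n : ℝ)))) (by linarith) n
    rw [hq, sub_eq_add_neg]
    refine le_trans (le_of_eq ?_) this
    field_simp; norm_num
  nlinarith [norm_nonneg (blaschke σ z)]

/-! ### Hermite interpolation -/

/-- The part of `φ` carried by the zeros of `B_σ` extends analytically across the unit circle. -/
theorem exists_interpolant_integral {ρ : ℝ} (h0 : 0 < ρ) (h1 : ρ < 1) {σ : Multiset ℂ}
    (hσ : ∀ μ ∈ σ, ‖μ‖ < 1) (φ : ℂ → ℂ) (hφ : ContinuousOn φ (sphere 0 ρ)) :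
    ∃ G : ℂ → ℂ, (∀ ζ : ℂ, ‖ζ‖ ≤ 1 → DifferentiableAt ℂ G ζ) ∧
      ∀ ζ : ℂ, ‖ζ‖ ≤ 1 → ‖ζ‖ ≠ ρ → G ζ = (2 * Real.pi * I : ℂ)⁻¹ *
        ∮ z in C(0, ρ), φ z * ((blaschke σ z - blaschke σ ζ) / (z - ζ)) := by
  induction σ using Multiset.induction generalizing φ with
  | empty => exact ⟨0, fun _ _ => by fun_prop, by simp [blaschke_zero, circleIntegral]⟩
  | cons μ σ ih =>
    have hμ := hσ μ (by simp)
    have hσ' : ∀ ν ∈ σ, ‖ν‖ < 1 := fun ν hν => hσ ν (Multiset.mem_cons_of_mem hν)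
    have hzle : ∀ z ∈ sphere (0 : ℂ) ρ, ‖z‖ ≤ 1 := fun z hz => by
      rw [mem_sphere_zero_iff_norm.1 hz]; exact h1.le
    have hbc : ContinuousOn (blaschkeFactor μ) (sphere 0 ρ) := fun z hz =>
      (differentiableAt_blaschkeFactor hμ (hzle z hz)).continuousAt.continuousWithinAt
    have hBc : ContinuousOn (blaschke σ) (sphere 0 ρ) := fun z hz =>
      (differentiableAt_blaschke hσ' (hzle z hz)).continuousAt.continuousWithinAt
    -- Adding the zero `μ` splits the difference as `b_μ(z) (B(z) - B(ζ)) + (b_μ(z) - b_μ(ζ)) B(ζ)`.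
    -- The first term is the induction hypothesis with `b_μ` absorbed into `φ`. In the second,
    -- division by `z - ζ` leaves a product of a function of `z` and a function of `ζ`, whence the
    -- constant `c`.
    obtain ⟨G, hGd, hG⟩ := ih hσ' (fun z => φ z * blaschkeFactor μ z) (hφ.mul hbc)
    set c : ℂ := (2 * Real.pi * I : ℂ)⁻¹ *
      ∮ z in C(0, ρ), φ z * (((‖μ‖ : ℂ) ^ 2 - 1) / (1 - conj μ * z)) with hc
    refine ⟨fun ζ => G ζ + blaschke σ ζ * (1 - conj μ * ζ)⁻¹ * c, fun ζ hζ => ?_,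
      fun ζ hζ hζρ => ?_⟩
    · have hB := differentiableAt_blaschke hσ' hζ
      have hne := one_sub_conj_mul_ne_zero hμ hζ
      exact (hGd ζ hζ).add ((hB.mul (DifferentiableAt.inv (by fun_prop) hne)).mul_const c)
    · have hne := one_sub_conj_mul_ne_zero hμ hζ
      have hsub : ∀ z ∈ sphere (0 : ℂ) ρ, z - ζ ≠ 0 := fun z hz h => hζρ (by
        rw [← sub_eq_zero.1 h]; exact mem_sphere_zero_iff_norm.1 hz)
      beta_reduce
      rw [hG ζ hζ hζρ, hc, mul_left_comm, ← mul_add, ← circleIntegral.integral_const_mul,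
        ← circleIntegral.integral_add]
      · congr 1
        refine circleIntegral.integral_congr h0.le fun z hz => ?_
        have hz1 := one_sub_conj_mul_ne_zero hμ (hzle z hz)
        have hz2 := hsub z hz
        have hk : blaschkeFactor μ z - blaschkeFactor μ ζ =
            ((‖μ‖ : ℂ) ^ 2 - 1) / (1 - conj μ * z) * (1 - conj μ * ζ)⁻¹ * (z - ζ) := by
          rw [← Complex.conj_mul', blaschkeFactor, blaschkeFactor]
          have hz3 : 1 - z * conj μ ≠ 0 := by rwa [mul_comm]
          field_simp
          ring
        simp only [blaschke_cons]
        rw [show blaschkeFactor μ z * blaschke σ z - blaschkeFactor μ ζ * blaschke σ ζ =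
          blaschkeFactor μ z * (blaschke σ z - blaschke σ ζ) +
            (blaschkeFactor μ z - blaschkeFactor μ ζ) * blaschke σ ζ by ring, hk]
        field_simp
      · refine ContinuousOn.circleIntegrable h0.le ((hφ.mul hbc).mul ?_)
        exact (hBc.sub continuousOn_const).div (by fun_prop) hsub
      · refine ContinuousOn.circleIntegrable h0.le (continuousOn_const.mul (hφ.mul ?_))
        exact continuousOn_const.div (by fun_prop) fun z hz =>
          one_sub_conj_mul_ne_zero hμ (hzle z hz)

/-- **Hermite interpolation**: an interpolant of `f` on `σ`, holomorphic across the unit circle and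
given by a Cauchy integral over a smaller circle surrounding `σ`. -/
theorem exists_hermite_interpolant {ρ : ℝ} (h0 : 0 < ρ) (h1 : ρ < 1) {σ : Multiset ℂ}
    (hσ : ∀ μ ∈ σ, ‖μ‖ < ρ) {f : ℂ → ℂ} (hf : DifferentiableOn ℂ f disc) :
    ∃ G : ℂ → ℂ, (∀ ζ : ℂ, ‖ζ‖ ≤ 1 → DifferentiableAt ℂ G ζ) ∧ SameTrace σ f G ∧
      ∀ ζ : ℂ, ‖ζ‖ = 1 → G ζ = (2 * Real.pi * I : ℂ)⁻¹ *
        ∮ z in C(0, ρ), f z / blaschke σ z * ((blaschke σ z - blaschke σ ζ) / (z - ζ)) := by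
  have hσ1 : ∀ μ ∈ σ, ‖μ‖ < 1 := fun μ hμ => (hσ μ hμ).trans h1
  have hzle : ∀ z ∈ sphere (0 : ℂ) ρ, ‖z‖ ≤ 1 := fun z hz => by
    rw [mem_sphere_zero_iff_norm.1 hz]; exact h1.le
  have hout : ∀ z : ℂ, ρ ≤ ‖z‖ → ‖z‖ ≤ 1 → blaschke σ z ≠ 0 := fun z hz hz1 =>
    blaschke_ne_zero hσ1 hz1 fun hm => absurd (hσ z hm) (not_lt.2 hz)
  have hBne : ∀ z ∈ sphere (0 : ℂ) ρ, blaschke σ z ≠ 0 := fun z hz =>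
    hout z (mem_sphere_zero_iff_norm.1 hz).ge (hzle z hz)
  have hBc : ContinuousOn (blaschke σ) (sphere 0 ρ) := fun z hz =>
    (differentiableAt_blaschke hσ1 (hzle z hz)).continuousAt.continuousWithinAt
  have hfd : ∀ z : ℂ, ‖z‖ < 1 → DifferentiableAt ℂ f z := fun z hz =>
    hf.differentiableAt (isOpen_ball.mem_nhds (by simpa [disc] using hz))
  have hfc : ContinuousOn f (sphere 0 ρ) := fun z hz =>
    (hfd z (by rwa [mem_sphere_zero_iff_norm.1 hz])).continuousAt.continuousWithinAt
  have hφ : ContinuousOn (fun z => f z / blaschke σ z) (sphere 0 ρ) := hfc.div hBc hBne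
  obtain ⟨G, hGd, hG⟩ := exists_interpolant_integral h0 h1 hσ1 _ hφ
  refine ⟨G, hGd, ?_, fun ζ hζ => hG ζ hζ.le (by rw [hζ]; exact h1.ne')⟩
  -- Inside the circle `f` is its own Cauchy integral. Subtracting the formula for `G` leaves `B(ζ)`
  -- times the Cauchy integral of `f / B`.
  set H : ℂ → ℂ := fun w => (2 * Real.pi * I : ℂ)⁻¹ •
    ∮ z in C(0, ρ), (z - w)⁻¹ • (f z / blaschke σ z) with hH
  have hHd : DifferentiableOn ℂ H (ball 0 ρ) := by
    obtain ⟨R, rfl⟩ : ∃ R : NNReal, (R : ℝ) = ρ := ⟨⟨ρ, h0.le⟩, rfl⟩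
    have := (hasFPowerSeriesOn_cauchy_integral (c := 0)
      (ContinuousOn.circleIntegrable h0.le hφ) (by exact_mod_cast h0)).differentiableOn
    rwa [Metric.eball_coe] at this
  have hin : ∀ ζ : ℂ, ‖ζ‖ < ρ → f ζ - G ζ = blaschke σ ζ * H ζ := by
    intro ζ hζ
    have hsub : ∀ z ∈ sphere (0 : ℂ) ρ, z - ζ ≠ 0 := fun z hz h => hζ.ne (by
        rw [← sub_eq_zero.1 h]; exact mem_sphere_zero_iff_norm.1 hz)
    have hcauchy : (2 * Real.pi * I : ℂ)⁻¹ • ∮ z in C(0, ρ), (z - ζ)⁻¹ • f z = f ζ := by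
      apply DiffContOnCl.two_pi_i_inv_smul_circleIntegral_sub_inv_smul _ (by simpa using hζ)
      refine DifferentiableOn.diffContOnCl fun z hz => ?_
      rw [closure_ball _ h0.ne', mem_closedBall_zero_iff] at hz
      exact (hfd z (hz.trans_lt h1)).differentiableWithinAt
    rw [hG ζ (hζ.le.trans h1.le) hζ.ne]
    nth_rewrite 1 [← hcauchy]
    simp only [hH, smul_eq_mul]
    rw [mul_left_comm, ← mul_sub, ← circleIntegral.integral_const_mul,
      ← circleIntegral.integral_sub]
    · congr 1
      refine circleIntegral.integral_congr h0.le fun z hz => ?_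
      have := hBne z hz
      have := hsub z hz
      field_simp
      ring
    · exact ContinuousOn.circleIntegrable h0.le
        ((ContinuousOn.inv₀ (by fun_prop) hsub).mul hfc)
    · exact ContinuousOn.circleIntegrable h0.le
        (hφ.mul ((hBc.sub continuousOn_const).div (by fun_prop) hsub))
  classical
  -- The quotient is `H` inside the circle, where `B` may vanish, and `(f - G) / B` elsewhere, where
  -- it does not. By `hin` the two agree inside wherever `B ≠ 0`, in particular near the circle, so
  -- the gluing is holomorphic.
  refine ⟨fun z => if ‖z‖ < ρ then H z else (f z - G z) / blaschke σ z, ?_, fun z hz => ?_⟩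
  · intro z hz
    replace hz : ‖z‖ < 1 := by simpa [disc] using hz
    apply DifferentiableAt.differentiableWithinAt
    by_cases hzρ : ‖z‖ < ρ
    · have hmem : ball (0 : ℂ) ρ ∈ 𝓝 z := isOpen_ball.mem_nhds (by simpa using hzρ)
      refine (hHd.differentiableAt hmem).congr_of_eventuallyEq ?_
      filter_upwards [hmem] with w hw
      rw [if_pos (by simpa using hw)]
    · have hB0 := hout z (not_lt.1 hzρ) hz.le
      have hBd := differentiableAt_blaschke hσ1 hz.le
      refine (((hfd z hz).sub (hGd z hz.le)).div hBd hB0).congr_of_eventuallyEq ?_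
      filter_upwards [hBd.continuousAt.eventually_ne hB0] with w hw
      split_ifs with h
      · rw [Pi.div_apply, Pi.sub_apply, hin w h, mul_div_cancel_left₀ _ hw]
      · rfl
  · replace hz : ‖z‖ < 1 := by simpa [disc] using hz
    beta_reduce
    split_ifs with h
    · exact hin z h
    · rw [mul_div_cancel₀ _ (hout z (not_lt.1 h) hz.le)]

/-! ### Growth of mean squares in the unit ball of `l_a^p(α)` -/

/-- With `x = δ(k + 1)`, the power `x^γ` is at most a constant times `e^x`, while `(1 - δ)^k ≤ e ·
e^(-x)`. -/
theorem exists_rpow_mul_pow_le {γ : ℝ} (hγ : 0 ≤ γ) : ∃ C : ℝ, 0 < C ∧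
    ∀ δ : ℝ, 0 < δ → δ ≤ 1 → ∀ k : ℕ, ((k : ℝ) + 1) ^ γ * (1 - δ) ^ k ≤ C * δ ^ (-γ) := by
  set K := ⌈γ⌉₊
  have hK : γ ≤ K := Nat.le_ceil γ
  refine ⟨(1 + K.factorial) * Real.exp 1, by positivity, fun δ hδ hδ1 k => ?_⟩
  have hk : (0 : ℝ) < k + 1 := by positivity
  have hx : 0 < δ * (k + 1) := by positivity
  have h1 : (δ * (k + 1)) ^ γ ≤ (1 + K.factorial) * Real.exp (δ * (k + 1)) := by
    have hle : (δ * ((k : ℝ) + 1)) ^ γ ≤ 1 + (δ * (k + 1)) ^ K := by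
      rcases le_total (δ * ((k : ℝ) + 1)) 1 with h | h
      · have := Real.rpow_le_one hx.le h hγ
        have : 0 ≤ (δ * ((k : ℝ) + 1)) ^ K := by positivity
        linarith
      · have := Real.rpow_le_rpow_of_exponent_le h hK
        rw [Real.rpow_natCast] at this
        linarith
    have h2 := Real.pow_div_factorial_le_exp _ hx.le K
    rw [div_le_iff₀ (by positivity)] at h2
    have h3 := Real.one_le_exp hx.le
    nlinarith
  have h2 : (1 - δ) ^ k ≤ Real.exp 1 * Real.exp (-(δ * (k + 1))) := by
    have : 1 - δ ≤ Real.exp (-δ) := by linarith [Real.add_one_le_exp (-δ)]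
    calc (1 - δ) ^ k ≤ Real.exp (-δ) ^ k := pow_le_pow_left₀ (by linarith) this k
      _ = Real.exp (-(δ * k)) := by rw [← Real.exp_nat_mul]; ring_nf
      _ ≤ Real.exp (1 + -(δ * (k + 1))) := Real.exp_le_exp.2 (by linarith)
      _ = _ := Real.exp_add _ _
  calc ((k : ℝ) + 1) ^ γ * (1 - δ) ^ k
      = δ ^ (-γ) * ((δ * (k + 1)) ^ γ * (1 - δ) ^ k) := by
        rw [Real.mul_rpow hδ.le hk.le, Real.rpow_neg hδ.le]
        field_simp
    _ ≤ δ ^ (-γ) * ((1 + K.factorial) * Real.exp (δ * (k + 1)) *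
          (Real.exp 1 * Real.exp (-(δ * (k + 1))))) := by
        have : 0 ≤ (1 - δ) ^ k := pow_nonneg (by linarith) k
        gcongr
    _ = _ := by
        rw [Real.exp_neg]
        field_simp

theorem norm_taylorCoeff_le_one_of_lapNorm_top {α : ℝ} {f : ℂ → ℂ} (h : lapNorm ∞ α f ≤ 1)
    (k : ℕ) : ‖taylorCoeff f k‖ * ((k : ℝ) + 1) ^ α ≤ 1 := by
  rw [lapNorm, if_pos rfl] at h
  have := (le_iSup (fun k : ℕ => ENNReal.ofReal (‖taylorCoeff f k‖ * ((k : ℝ) + 1) ^ α)) k).trans h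
  rwa [ENNReal.ofReal_le_one] at this

theorem sum_rpow_le_one_of_lapNorm {p : ℝ≥0∞} (hp : 2 ≤ p) (hp' : p ≠ ∞) {α : ℝ} {f : ℂ → ℂ}
    (h : lapNorm p α f ≤ 1) (M : ℕ) :
    ∑ k ∈ Finset.range M, (‖taylorCoeff f k‖ * ((k : ℝ) + 1) ^ α) ^ p.toReal ≤ 1 := by
  have hq : 0 < p.toReal := ENNReal.toReal_pos (by rintro rfl; simp at hp) hp'
  rw [lapNorm, if_neg hp', one_div, ENNReal.rpow_inv_le_iff hq, ENNReal.one_rpow] at h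
  have h2 := (ENNReal.sum_le_tsum (Finset.range M)).trans h
  rw [← ENNReal.ofReal_sum_of_nonneg (fun _ _ => by positivity), ENNReal.ofReal_le_one] at h2
  refine le_trans (le_of_eq (Finset.sum_congr rfl fun k _ => ?_)) h2
  rw [Real.mul_rpow (by positivity) (by positivity), ← Real.rpow_mul (by positivity),
    mul_comm α]

theorem sum_pow_one_sub_le {δ : ℝ} (h0 : 0 < δ) (h1 : δ ≤ 1) (M : ℕ) :
    ∑ k ∈ Finset.range M, (1 - δ) ^ k ≤ δ⁻¹ := by
  have h := tsum_geometric_of_lt_one (r := 1 - δ) (by linarith) (by linarith)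
  rw [sub_sub_cancel] at h
  rw [← h]
  exact (summable_geometric_of_lt_one (by linarith) (by linarith)).sum_le_tsum _
    fun k _ => pow_nonneg (by linarith) k

/-- A substitute for Hölder's inequality: below the threshold `1/T` the constant term dominates,
above it `(T x)^(q - 2) ≥ 1`. -/
theorem sq_le_rpow_mul_add {x T q : ℝ} (hx : 0 ≤ x) (hT : 0 < T) (hq : 2 ≤ q) :
    x ^ 2 ≤ T ^ (q - 2) * x ^ q + T ^ (-2 : ℝ) := by
  have hT2 : T ^ (-2 : ℝ) = (T⁻¹) ^ 2 := by
    rw [Real.rpow_neg hT.le, inv_pow]; norm_cast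
  rcases le_total x T⁻¹ with h | h
  · have : x ^ 2 ≤ (T⁻¹) ^ 2 := by gcongr
    have : 0 ≤ T ^ (q - 2) * x ^ q := by positivity
    linarith
  · have hx0 : 0 < x := (inv_pos.2 hT).trans_le h
    have h1 : 1 ≤ (T * x) ^ (q - 2) := by
      apply Real.one_le_rpow _ (by linarith)
      rwa [inv_le_iff_one_le_mul₀' hT] at h
    have h2 : T ^ (q - 2) * x ^ q = (T * x) ^ (q - 2) * x ^ 2 := by
      rw [Real.mul_rpow hT.le hx, mul_assoc, ← Real.rpow_natCast x 2, ← Real.rpow_add hx0]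
      norm_num
    have : 0 ≤ T ^ (-2 : ℝ) := by positivity
    rw [h2]
    nlinarith [sq_nonneg x]

theorem sum_sq_mul_pow_le_of_lapNorm {p : ℝ≥0∞} (hp : 2 ≤ p) {α : ℝ} {f : ℂ → ℂ}
    (h : lapNorm p α f ≤ 1) {δ : ℝ} (h0 : 0 < δ) (h1 : δ ≤ 1) (M : ℕ) :
    ∑ k ∈ Finset.range M, (‖taylorCoeff f k‖ * ((k : ℝ) + 1) ^ α) ^ 2 * (1 - δ) ^ k ≤
      2 * δ ^ (-(1 - 2 * p⁻¹.toReal)) := by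
  have hδ : ∀ k : ℕ, 0 ≤ (1 - δ) ^ k := fun k => pow_nonneg (by linarith) k
  by_cases hp' : p = ∞
  · subst hp'
    have hs := sum_pow_one_sub_le h0 h1 M
    have hle : ∑ k ∈ Finset.range M, (‖taylorCoeff f k‖ * ((k : ℝ) + 1) ^ α) ^ 2 * (1 - δ) ^ k ≤
        ∑ k ∈ Finset.range M, (1 - δ) ^ k := by
      refine Finset.sum_le_sum fun k _ => mul_le_of_le_one_left (hδ k) ?_
      exact pow_le_one₀ (by positivity) (norm_taylorCoeff_le_one_of_lapNorm_top h k)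
    have hinv : 0 < δ⁻¹ := inv_pos.2 h0
    simp only [ENNReal.inv_top, ENNReal.toReal_zero, mul_zero, sub_zero, Real.rpow_neg_one]
    linarith
  · rw [ENNReal.toReal_inv]
    have hq : 2 ≤ p.toReal := by
      simpa using (ENNReal.toReal_le_toReal (by simp) hp').2 hp
    set q := p.toReal
    have hq0 : 0 < q := by linarith
    -- This threshold balances the two sums: `T^(q - 2) = T^(-2) δ⁻¹`.
    set T : ℝ := δ ^ (-q⁻¹) with hT
    have hT0 : 0 < T := Real.rpow_pos_of_pos h0 _
    have e1 : T ^ (q - 2) = δ ^ (-(1 - 2 * q⁻¹)) := by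
      rw [hT, ← Real.rpow_mul h0.le]; congr 1; field_simp
    have e2 : T ^ (-2 : ℝ) * δ⁻¹ = δ ^ (-(1 - 2 * q⁻¹)) := by
      rw [hT, ← Real.rpow_mul h0.le, ← Real.rpow_neg_one δ, ← Real.rpow_add h0]; congr 1; ring
    calc _ ≤ ∑ k ∈ Finset.range M,
          (T ^ (q - 2) * (‖taylorCoeff f k‖ * ((k : ℝ) + 1) ^ α) ^ q +
            T ^ (-2 : ℝ) * (1 - δ) ^ k) := by
          refine Finset.sum_le_sum fun k _ => ?_
          set x := ‖taylorCoeff f k‖ * ((k : ℝ) + 1) ^ α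
          have hx : 0 ≤ x := by positivity
          have hk : (1 - δ) ^ k ≤ 1 := pow_le_one₀ (by linarith) (by linarith)
          have hxq : 0 ≤ T ^ (q - 2) * x ^ q := by positivity
          calc x ^ 2 * (1 - δ) ^ k ≤ (T ^ (q - 2) * x ^ q + T ^ (-2 : ℝ)) * (1 - δ) ^ k :=
                mul_le_mul_of_nonneg_right (sq_le_rpow_mul_add hx hT0 hq) (hδ k)
            _ ≤ _ := by
                rw [add_mul]
                exact add_le_add_left (mul_le_of_le_one_right hxq hk) _
      _ = T ^ (q - 2) * ∑ k ∈ Finset.range M, (‖taylorCoeff f k‖ * ((k : ℝ) + 1) ^ α) ^ q +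
            T ^ (-2 : ℝ) * ∑ k ∈ Finset.range M, (1 - δ) ^ k := by
          rw [Finset.sum_add_distrib, Finset.mul_sum, Finset.mul_sum]
      _ ≤ T ^ (q - 2) * 1 + T ^ (-2 : ℝ) * δ⁻¹ := by
          gcongr
          · exact sum_rpow_le_one_of_lapNorm hp hp' h M
          · exact sum_pow_one_sub_le h0 h1 M
      _ = _ := by rw [e1, e2]; ring

/-- Growth of the quadratic means of functions in the unit ball of `l_a^p(α)`. -/
theorem exists_circleAverage_norm_sq_le_of_lapNorm {p : ℝ≥0∞} (hp : 2 ≤ p) {α : ℝ} (hα : α ≤ 0) :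
    ∃ C : ℝ, 0 < C ∧ ∀ f : ℂ → ℂ, DifferentiableOn ℂ f disc → lapNorm p α f ≤ 1 →
      ∀ δ : ℝ, 0 < δ → δ ≤ 1 → circleAverage (fun z => ‖f z‖ ^ 2) 0 (1 - δ) ≤
        C * δ ^ (-(1 - 2 * α - 2 * p⁻¹.toReal)) := by
  obtain ⟨C, hC, hCb⟩ := exists_rpow_mul_pow_le (γ := -2 * α) (by linarith)
  refine ⟨C * 2, by positivity, fun f hf h δ h0 h1 => ?_⟩
  have hδ0 : 0 ≤ 1 - δ := by linarith
  have hnorm : ‖((1 - δ : ℝ) : ℂ)‖ = 1 - δ := by simp only [norm_real, Real.norm_of_nonneg hδ0]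
  rw [Real.circleAverage_eq_circleAverage_zero_one]
  apply circleAverage_norm_sq_le (a := fun k => taylorCoeff f k * ((1 - δ : ℝ) : ℂ) ^ k)
  · exact (hasSum_taylorCoeff hf (by rw [hnorm]; linarith)).summable.norm
  · intro z hz
    have := hasSum_taylorCoeff hf (z := ((1 - δ : ℝ) : ℂ) * z + 0)
      (by rw [add_zero, norm_mul, hnorm, hz]; linarith)
    convert! this using 1
    ext k; rw [add_zero, mul_pow, mul_assoc]
  · intro M
    calc _ ≤ ∑ k ∈ Finset.range M, C * δ ^ (-(-2 * α)) *
          ((‖taylorCoeff f k‖ * ((k : ℝ) + 1) ^ α) ^ 2 * (1 - δ) ^ k) := by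
          refine Finset.sum_le_sum fun k _ => ?_
          have hk : (0 : ℝ) < k + 1 := by positivity
          -- One of the two factors `(1 - δ)^k` absorbs the weight `(k + 1)^(-2α)`; the other is
          -- kept for the summation.
          have e : ‖taylorCoeff f k * ((1 - δ : ℝ) : ℂ) ^ k‖ ^ 2 =
              (((k : ℝ) + 1) ^ (-2 * α) * (1 - δ) ^ k) *
              ((‖taylorCoeff f k‖ * ((k : ℝ) + 1) ^ α) ^ 2 * (1 - δ) ^ k) := by
            have : ((k : ℝ) + 1) ^ (-2 * α) * (((k : ℝ) + 1) ^ α) ^ 2 = 1 := by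
              rw [← Real.rpow_natCast, ← Real.rpow_mul hk.le, ← Real.rpow_add hk]
              norm_num
              ring_nf
              simp
            rw [norm_mul, norm_pow, hnorm, mul_pow, mul_pow]
            linear_combination (-1) * ‖taylorCoeff f k‖ ^ 2 * ((1 - δ) ^ k) ^ 2 * this
          rw [e]
          have : 0 ≤ (1 - δ) ^ k := pow_nonneg hδ0 k
          exact mul_le_mul_of_nonneg_right (hCb δ h0 h1 k) (by positivity)
      _ ≤ C * δ ^ (-(-2 * α)) * (2 * δ ^ (-(1 - 2 * p⁻¹.toReal))) := by
          rw [← Finset.mul_sum]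
          gcongr
          exact sum_sq_mul_pow_le_of_lapNorm hp h h0 h1 M
      _ = C * 2 * (δ ^ (-(-2 * α)) * δ ^ (-(1 - 2 * p⁻¹.toReal))) := by ring
      _ = _ := by rw [← Real.rpow_add h0]; congr 2; ring

/-! ### The upper bound -/

/-- A bounded interpolant of a function in the unit ball of `l_a^p(α)`. -/
theorem exists_bounded_interpolant {p : ℝ≥0∞} (hp : 2 ≤ p) {α : ℝ} (hα : α ≤ 0) :
    ∃ C : ℝ, 0 < C ∧ ∀ (n : ℕ) (r : ℝ), 1 ≤ n → 0 ≤ r → r < 1 → ∀ σ : Multiset ℂ,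
      σ.card ≤ n → (∀ μ ∈ σ, ‖μ‖ ≤ r) → ∀ f : ℂ → ℂ, DifferentiableOn ℂ f disc →
      lapNorm p α f ≤ 1 → ∃ G : ℂ → ℂ, DifferentiableOn ℂ G disc ∧ SameTrace σ f G ∧
        ∀ z ∈ disc, ‖G z‖ ≤ C * ((n : ℝ) / (1 - r)) ^ (1 - α - p⁻¹.toReal) := by
  obtain ⟨C, hC, hCb⟩ := exists_circleAverage_norm_sq_le_of_lapNorm hp hα
  set t := p⁻¹.toReal with ht
  refine ⟨3 / 2 * (C + 1) * 8 ^ (1 - α - t), by positivity, fun n r hn h0 hr σ hc hσ f hf h => ?_⟩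
  have hn' : (1 : ℝ) ≤ n := by exact_mod_cast hn
  have hr0 : 0 < 1 - r := by linarith
  set δ : ℝ := (1 - r) / (8 * n) with hδ
  have hδ0 : 0 < δ := by positivity
  have hδr : δ < 1 - r := by
    rw [hδ, div_lt_iff₀ (by positivity)]; nlinarith
  have hρ0 : 0 < 1 - δ := by linarith
  have hρ1 : 1 - δ < 1 := by linarith
  obtain ⟨G, hGd, hGt, hG⟩ := exists_hermite_interpolant hρ0 hρ1 (σ := σ)
    (fun μ hμ => (hσ μ hμ).trans_lt (by linarith)) hf
  have hσ1 : ∀ μ ∈ σ, ‖μ‖ < 1 := fun μ hμ => (hσ μ hμ).trans_lt hr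
  have hzn : ∀ z ∈ sphere (0 : ℂ) (1 - δ), ‖z‖ = 1 - δ := fun z hz => mem_sphere_zero_iff_norm.1 hz
  have hBlow : ∀ z ∈ sphere (0 : ℂ) (1 - δ), 1 / 2 ≤ ‖blaschke σ z‖ := fun z hz =>
    half_le_norm_blaschke hn hr h0 hc hσ (hzn z hz)
  have hBne : ∀ z ∈ sphere (0 : ℂ) (1 - δ), blaschke σ z ≠ 0 := fun z hz =>
    norm_pos_iff.1 (lt_of_lt_of_le (by norm_num) (hBlow z hz))
  have hBc : ContinuousOn (blaschke σ) (sphere 0 (1 - δ)) := fun z hz =>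
    (differentiableAt_blaschke hσ1 (by rw [hzn z hz]; linarith)).continuousAt.continuousWithinAt
  have hfc : ContinuousOn f (sphere 0 (1 - δ)) := hf.continuousOn.mono fun z hz => by
    rw [disc, mem_ball_zero_iff, hzn z hz]; exact hρ1
  -- The AM-GM weight that equalises the two contributions: `c δ^(-(1 - 2α - 2t)) = c⁻¹ δ⁻¹`.
  set c : ℝ := δ ^ (-α - t) with hcdef
  have hc0 : 0 < c := Real.rpow_pos_of_pos hδ0 _
  have hbdry : ∀ ζ : ℂ, ‖ζ‖ = 1 → ‖G ζ‖ ≤ 3 / 2 * (C + 1) * δ ^ (-(1 - α - t)) := by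
    intro ζ hζ
    have hsub : ∀ z ∈ sphere (0 : ℂ) (1 - δ), z - ζ ≠ 0 := fun z hz h => by
      have := hzn z hz
      rw [sub_eq_zero.1 h, hζ] at this
      linarith
    have hkc : ContinuousOn (fun z => (z - ζ)⁻¹) (sphere 0 (1 - δ)) :=
      ContinuousOn.inv₀ (by fun_prop) hsub
    have hi1 : CircleIntegrable (fun z => 3 / 2 * (c * ‖f z‖ ^ 2)) 0 (1 - δ) :=
      ContinuousOn.circleIntegrable hρ0.le
        (continuousOn_const.mul (continuousOn_const.mul (hfc.norm.pow 2)))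
    have hi2 : CircleIntegrable (fun z => 3 / 2 * (c⁻¹ * ‖(z - ζ)⁻¹‖ ^ 2)) 0 (1 - δ) :=
      ContinuousOn.circleIntegrable hρ0.le
        (continuousOn_const.mul (continuousOn_const.mul (hkc.norm.pow 2)))
    rw [hG ζ hζ]
    refine (norm_circleIntegral_le_circleAverage hρ0.le).trans ?_
    have hmono : circleAverage
        (fun z => ‖f z / blaschke σ z * ((blaschke σ z - blaschke σ ζ) / (z - ζ))‖) 0 (1 - δ) ≤
        circleAverage (fun z => 3 / 2 * (c * ‖f z‖ ^ 2) + 3 / 2 * (c⁻¹ * ‖(z - ζ)⁻¹‖ ^ 2))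
          0 (1 - δ) := by
      apply Real.circleAverage_mono
      · exact ContinuousOn.circleIntegrable hρ0.le ((hfc.div hBc hBne).mul
          ((hBc.sub continuousOn_const).div (by fun_prop) hsub)).norm
      · exact hi1.add hi2
      · rw [abs_of_pos hρ0]
        intro z hz
        have hB := hBlow z hz
        have hBpos : 0 < ‖blaschke σ z‖ := by linarith
        -- Here `|B(ζ)| = 1 ≤ 2 |B(z)|`, so the factor `|B(z)|` cancels the denominator of `f / B`.
        have h1 : ‖blaschke σ z - blaschke σ ζ‖ ≤ 3 * ‖blaschke σ z‖ := by
          refine (norm_sub_le _ _).trans ?_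
          rw [norm_blaschke_eq_one hσ1 hζ]
          linarith
        have h2 : ‖f z / blaschke σ z * ((blaschke σ z - blaschke σ ζ) / (z - ζ))‖ ≤
            3 * (‖f z‖ * ‖(z - ζ)⁻¹‖) := by
          rw [norm_mul, norm_div, norm_div, norm_inv]
          calc ‖f z‖ / ‖blaschke σ z‖ * (‖blaschke σ z - blaschke σ ζ‖ / ‖z - ζ‖) ≤
                ‖f z‖ / ‖blaschke σ z‖ * (3 * ‖blaschke σ z‖ / ‖z - ζ‖) := by gcongr
            _ = _ := by field_simp
        have h3 : c * ‖f z‖ ^ 2 + c⁻¹ * ‖(z - ζ)⁻¹‖ ^ 2 - 2 * (‖f z‖ * ‖(z - ζ)⁻¹‖) =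
            c * (‖f z‖ - c⁻¹ * ‖(z - ζ)⁻¹‖) ^ 2 := by
          field_simp
          ring
        have h4 : 0 ≤ c * (‖f z‖ - c⁻¹ * ‖(z - ζ)⁻¹‖) ^ 2 := by positivity
        linarith
    rw [Real.circleAverage_fun_add hi1 hi2] at hmono
    have hA1 := hCb f hf h δ hδ0 (by linarith)
    have hA2 : circleAverage (fun z => ‖(z - ζ)⁻¹‖ ^ 2) 0 (1 - δ) ≤ δ⁻¹ := by
      refine (circleAverage_norm_sq_inv_sub_le hρ0.le hρ1 hζ).trans ?_
      gcongr
      nlinarith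
    have e1 : circleAverage (fun z => 3 / 2 * (c * ‖f z‖ ^ 2)) 0 (1 - δ) =
        3 / 2 * (c * circleAverage (fun z => ‖f z‖ ^ 2) 0 (1 - δ)) := by
      simp only [← smul_eq_mul (3 / 2 : ℝ), ← smul_eq_mul c]
      rw [Real.circleAverage_fun_smul, Real.circleAverage_fun_smul]
    have e2 : circleAverage (fun z => 3 / 2 * (c⁻¹ * ‖(z - ζ)⁻¹‖ ^ 2)) 0 (1 - δ) =
        3 / 2 * (c⁻¹ * circleAverage (fun z => ‖(z - ζ)⁻¹‖ ^ 2) 0 (1 - δ)) := by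
      simp only [← smul_eq_mul (3 / 2 : ℝ), ← smul_eq_mul c⁻¹]
      rw [Real.circleAverage_fun_smul, Real.circleAverage_fun_smul]
    rw [e1, e2] at hmono
    have hnn : 0 ≤ circleAverage
        (fun z => ‖f z / blaschke σ z * ((blaschke σ z - blaschke σ ζ) / (z - ζ))‖) 0 (1 - δ) :=
      Real.circleAverage_nonneg_of_nonneg fun _ _ => norm_nonneg _
    refine (mul_le_of_le_one_left hnn hρ1.le).trans (hmono.trans ?_)
    have e3 : c * δ ^ (-(1 - 2 * α - 2 * t)) = δ ^ (-(1 - α - t)) := by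
      rw [hcdef, ← Real.rpow_add hδ0]; congr 1; ring
    have e4 : c⁻¹ * δ⁻¹ = δ ^ (-(1 - α - t)) := by
      rw [hcdef, ← Real.rpow_neg hδ0.le, ← Real.rpow_neg_one δ, ← Real.rpow_add hδ0]; congr 1; ring
    calc _ ≤ 3 / 2 * (c * (C * δ ^ (-(1 - 2 * α - 2 * t)))) + 3 / 2 * (c⁻¹ * δ⁻¹) := by
          gcongr
      _ = 3 / 2 * (C * (c * δ ^ (-(1 - 2 * α - 2 * t))) + c⁻¹ * δ⁻¹) := by ring
      _ = _ := by rw [e3, e4]; ring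
  have e5 : δ ^ (-(1 - α - t)) = 8 ^ (1 - α - t) * ((n : ℝ) / (1 - r)) ^ (1 - α - t) := by
    rw [Real.rpow_neg hδ0.le, ← Real.inv_rpow hδ0.le, ← Real.mul_rpow (by norm_num) (by positivity)]
    congr 1
    rw [hδ]; field_simp
  refine ⟨G, fun z hz => (hGd z ?_).differentiableWithinAt, hGt, fun z hz => ?_⟩
  · rw [disc, mem_ball_zero_iff] at hz; exact hz.le
  · rw [mul_assoc _ _ (_ ^ _), ← e5]
    refine Complex.norm_le_of_forall_mem_frontier_norm_le (U := ball 0 1) isBounded_ball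
      (DifferentiableOn.diffContOnCl fun w hw => (hGd w ?_).differentiableWithinAt)
      (fun w hw => hbdry w ?_) (subset_closure hz)
    · rwa [closure_ball _ one_ne_zero, mem_closedBall_zero_iff] at hw
    · rwa [frontier_ball _ one_ne_zero, mem_sphere_zero_iff_norm] at hw

/-! ### A Fejér-type functional on Taylor coefficients -/

theorem circleIntegral_polynomial_div_pow (P : Polynomial ℂ) (m : ℕ) {s : ℝ} (hs : 0 < s) :
    (2 * Real.pi * I : ℂ)⁻¹ * ∮ z in C(0, s), P.eval z / z ^ (m + 1) = P.coeff m := by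
  have hz0 : ∀ z ∈ sphere (0 : ℂ) s, z ≠ 0 := fun z hz h => by
    rw [mem_sphere_zero_iff_norm, h, norm_zero] at hz; exact hs.ne hz
  have hint : ∀ P : Polynomial ℂ, CircleIntegrable (fun z => P.eval z / z ^ (m + 1)) 0 s :=
    fun P => ContinuousOn.circleIntegrable hs.le
      (P.continuous.continuousOn.div (by fun_prop) fun z hz => pow_ne_zero _ (hz0 z hz))
  induction P using Polynomial.induction_on' with
  | add P Q hP hQ =>
    simp only [Polynomial.eval_add, add_div, Polynomial.coeff_add]
    rw [circleIntegral.integral_add (hint P) (hint Q), mul_add, hP, hQ]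
  | monomial k a =>
    have h : (∮ z in C(0, s), (Polynomial.monomial k a).eval z / z ^ (m + 1)) =
        a * ∮ z in C(0, s), (z - 0) ^ ((k : ℤ) - m - 1) := by
      rw [← circleIntegral.integral_const_mul]
      refine circleIntegral.integral_congr hs.le fun z hz => ?_
      have := hz0 z hz
      simp only [Polynomial.eval_monomial, sub_zero]
      rw [mul_div_assoc, show (k : ℤ) - m - 1 = (k : ℤ) - ((m + 1 : ℕ) : ℤ) by push_cast; ring,
        zpow_sub₀ this, zpow_natCast, zpow_natCast]
    rw [h, Polynomial.coeff_monomial]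
    split_ifs with hk
    · subst hk
      have : (k : ℤ) - k - 1 = -1 := by ring
      simp only [this, zpow_neg_one, sub_zero]
      have h2 := circleIntegral.integral_sub_center_inv (0 : ℂ) hs.ne'
      simp only [sub_zero] at h2
      rw [h2]
      have := Complex.two_pi_I_ne_zero
      field_simp
    · rw [circleIntegral.integral_sub_zpow_of_ne (by omega)]
      simp

/-- The polynomial `1 + X + ⋯ + X ^ (n - 1)`. -/
noncomputable def geomPoly (n : ℕ) : Polynomial ℂ := ∑ j ∈ Finset.range n, Polynomial.X ^ j

theorem geomPoly_eval (n : ℕ) (z : ℂ) : (geomPoly n).eval z = ∑ j ∈ Finset.range n, z ^ j := by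
  simp [geomPoly, Polynomial.eval_finsetSum]

theorem geomPoly_coeff (n k : ℕ) : (geomPoly n).coeff k = if k < n then 1 else 0 := by
  simp [geomPoly, Polynomial.finsetSum_coeff, Polynomial.coeff_X_pow]

theorem geomPoly_sq_coeff {n k : ℕ} (h : k < n) : (geomPoly n ^ 2).coeff k = (k : ℂ) + 1 := by
  rw [sq, Polynomial.coeff_mul, Finset.Nat.sum_antidiagonal_eq_sum_range_succ_mk]
  rw [Finset.sum_congr rfl (g := fun _ => (1 : ℂ))]
  · simp
  · intro j hj
    rw [Finset.mem_range] at hj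
    rw [geomPoly_coeff, geomPoly_coeff, if_pos (by omega), if_pos (by omega), one_mul]

theorem mul_geomPoly_sq_coeff (A : Polynomial ℂ) (m : ℕ) :
    (A * geomPoly (m + 1) ^ 2).coeff m =
      ∑ k ∈ Finset.range (m + 1), A.coeff k * (((m + 1 : ℕ) : ℂ) - k) := by
  rw [Polynomial.coeff_mul, Finset.Nat.sum_antidiagonal_eq_sum_range_succ_mk]
  refine Finset.sum_congr rfl fun k hk => ?_
  rw [Finset.mem_range] at hk
  rw [geomPoly_sq_coeff (by omega), Nat.cast_sub (by omega)]
  push_cast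
  ring

theorem circleAverage_norm_sq_geomPoly_le (n : ℕ) {s : ℝ} (h0 : 0 ≤ s) (h1 : s ≤ 1) :
    circleAverage (fun z => ‖(geomPoly n).eval z‖ ^ 2) 0 s ≤ n := by
  rw [Real.circleAverage_eq_circleAverage_zero_one]
  apply circleAverage_norm_sq_le (a := fun k => if k < n then (s : ℂ) ^ k else 0)
  · refine summable_of_ne_finset_zero (s := Finset.range n) fun k hk => ?_
    rw [Finset.mem_range] at hk
    simp [hk]
  · intro z _
    have : (geomPoly n).eval ((s : ℂ) * z + 0) =
        ∑ k ∈ Finset.range n, (if k < n then (s : ℂ) ^ k else 0) * z ^ k := by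
      rw [geomPoly_eval]
      refine Finset.sum_congr rfl fun k hk => ?_
      rw [if_pos (Finset.mem_range.1 hk), add_zero, mul_pow]
    rw [this]
    refine hasSum_sum_of_ne_finset_zero fun k hk => ?_
    rw [Finset.mem_range] at hk
    simp [hk]
  · intro N
    calc _ ≤ ∑ k ∈ Finset.range N, if k < n then (1 : ℝ) else 0 := by
          refine Finset.sum_le_sum fun k _ => ?_
          split_ifs
          · rw [norm_pow, norm_real, Real.norm_of_nonneg h0, ← pow_mul]
            exact pow_le_one₀ h0 h1
          · simp
      _ ≤ n := by
          rw [Finset.sum_ite, Finset.sum_const_zero, add_zero, Finset.sum_const, nsmul_one]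
          norm_cast
          refine (Finset.card_le_card (t := Finset.range n) fun k hk => ?_).trans_eq
            (Finset.card_range n)
          exact Finset.mem_range.2 (Finset.mem_filter.1 hk).2

theorem blaschke_replicate_zero (n : ℕ) (z : ℂ) :
    blaschke (Multiset.replicate n 0) z = (-z) ^ n := by
  simp [blaschke, blaschkeFactor]

/-- A Fejér-type bound for the initial Taylor coefficients of a bounded holomorphic function. -/
theorem norm_sum_coeff_le_of_sameTrace {A : Polynomial ℂ} {m : ℕ} {g : ℂ → ℂ}
    (hg : DifferentiableOn ℂ g disc)
    (ht : SameTrace (Multiset.replicate (m + 1) 0) (fun z => A.eval z) g) {M : ℝ}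
    (hM : ∀ z ∈ disc, ‖g z‖ ≤ M) :
    ‖∑ k ∈ Finset.range (m + 1), A.coeff k * (((m + 1 : ℕ) : ℂ) - k)‖ ≤
      2 * M * ((m + 1 : ℕ) : ℝ) := by
  obtain ⟨h, hh, hfg⟩ := ht
  have hM0 : 0 ≤ M := (norm_nonneg _).trans (hM 0 (by simp [disc]))
  set n : ℝ := ((m + 1 : ℕ) : ℝ) with hn
  have hn1 : 1 ≤ n := by simp [hn]
  have hinv : 1 / (2 * n) ≤ 1 / 2 := by
    apply one_div_le_one_div_of_le <;> linarith
  have hinv0 : 0 < 1 / (2 * n) := by positivity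
  -- Since `g` is controlled only in the open disc, the circle is shrunk; `s ^ m ≥ 1/2` makes this
  -- cost at most a factor `2`.
  set s : ℝ := 1 - 1 / (2 * n) with hs
  have hs0 : 0 < s := by linarith
  have hs1 : s < 1 := by linarith
  -- A square is used so that the mean of `|Q|` is a mean square, bounded by `m + 1` through
  -- Parseval.
  set Q : Polynomial ℂ := geomPoly (m + 1) ^ 2 with hQ
  have hz0 : ∀ z ∈ sphere (0 : ℂ) s, z ≠ 0 := fun z hz h => by
    rw [mem_sphere_zero_iff_norm, h, norm_zero] at hz; exact hs0.ne hz
  have hsub : closedBall (0 : ℂ) s ⊆ disc := closedBall_subset_ball hs1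
  have hcont : ∀ {u : ℂ → ℂ}, DifferentiableOn ℂ u disc →
      ContinuousOn (fun z => u z * Q.eval z / z ^ (m + 1)) (sphere 0 s) := fun hu =>
    ((hu.continuousOn.mono (sphere_subset_closedBall.trans hsub)).mul
      Q.continuous.continuousOn).div (by fun_prop) fun z hz => pow_ne_zero _ (hz0 z hz)
  have hA : DifferentiableOn ℂ (fun z => A.eval z) disc := A.differentiable.differentiableOn
  -- The difference of the traces is `(-z)^(m + 1) h`, which cancels the pole and leaves a
  -- holomorphic integrand.
  have hdiff : (∮ z in C(0, s), A.eval z * Q.eval z / z ^ (m + 1)) =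
      ∮ z in C(0, s), g z * Q.eval z / z ^ (m + 1) := by
    rw [← sub_eq_zero, ← circleIntegral.integral_sub
      (ContinuousOn.circleIntegrable hs0.le (hcont hA))
      (ContinuousOn.circleIntegrable hs0.le (hcont hg))]
    have : (∮ z in C(0, s), (-1 : ℂ) ^ (m + 1) * (h z * Q.eval z)) = 0 := by
      refine DiffContOnCl.circleIntegral_eq_zero hs0.le (DifferentiableOn.diffContOnCl (𝕜 := ℂ) ?_)
      rw [closure_ball (0 : ℂ) hs0.ne']
      exact ((hh.mono hsub).mul Q.differentiable.differentiableOn).const_mul _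
    refine Eq.trans (circleIntegral.integral_congr hs0.le fun z hz => ?_) this
    have h1 := hfg z (hsub (sphere_subset_closedBall hz))
    rw [blaschke_replicate_zero, neg_pow] at h1
    have := hz0 z hz
    beta_reduce at h1 ⊢
    rw [← sub_div, ← sub_mul, h1]
    field_simp
  have hcoeff : (2 * Real.pi * I : ℂ)⁻¹ * ∮ z in C(0, s), g z * Q.eval z / z ^ (m + 1) =
      ∑ k ∈ Finset.range (m + 1), A.coeff k * (((m + 1 : ℕ) : ℂ) - k) := by
    rw [← hdiff, ← mul_geomPoly_sq_coeff, ← circleIntegral_polynomial_div_pow _ m hs0]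
    simp only [Polynomial.eval_mul, hQ]
  rw [← hcoeff]
  refine (norm_circleIntegral_le_circleAverage hs0.le).trans ?_
  have hspow : 1 / 2 ≤ s ^ m := by
    have h1 := one_add_mul_le_pow (a := -(1 / (2 * n))) (by linarith) m
    rw [hs, sub_eq_add_neg]
    refine le_trans ?_ h1
    have : (m : ℝ) * (1 / (2 * n)) ≤ 1 / 2 := by
      rw [mul_one_div, div_le_iff₀ (by positivity)]
      rw [hn]; push_cast; linarith
    linarith
  have hmono : circleAverage (fun z => ‖g z * Q.eval z / z ^ (m + 1)‖) 0 s ≤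
      circleAverage (fun z => (M / s ^ (m + 1)) • ‖(geomPoly (m + 1)).eval z‖ ^ 2) 0 s := by
    apply Real.circleAverage_mono
    · exact ContinuousOn.circleIntegrable hs0.le (hcont hg).norm
    · exact ContinuousOn.circleIntegrable hs0.le
        (Continuous.continuousOn (by fun_prop))
    · rw [abs_of_pos hs0]
      intro z hz
      rw [norm_div, norm_mul, norm_pow, mem_sphere_zero_iff_norm.1 hz, hQ, Polynomial.eval_pow,
        norm_pow, smul_eq_mul, div_mul_eq_mul_div]
      gcongr
      exact hM z (hsub (sphere_subset_closedBall hz))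
  rw [Real.circleAverage_fun_smul, smul_eq_mul] at hmono
  have hF := circleAverage_norm_sq_geomPoly_le (m + 1) hs0.le hs1.le
  calc _ ≤ s * (M / s ^ (m + 1) * n) := by
        gcongr
        exact hmono.trans (by gcongr)
    _ = M * n * (s ^ m)⁻¹ := by rw [pow_succ]; field_simp
    _ ≤ M * n * 2 := by
        gcongr
        rw [inv_le_comm₀ (by positivity) (by norm_num)]
        linarith
    _ = _ := by ring

/-! ### The test polynomial and the lower bound -/

theorem sum_succ_mul_sub (x : ℝ) (m : ℕ) :
    ∑ k ∈ Finset.range m, ((k : ℝ) + 1) * (x - k) =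
      x * m * (m + 1) / 2 - (m - 1) * m * (m + 1) / 3 := by
  induction m with
  | zero => simp
  | succ m ih => rw [Finset.sum_range_succ, ih]; push_cast; ring

/-- The larger of `u`, `v` is at least their mean, and the smaller is at least `u v / (u + v)`; one
term of the right side already suffices. -/
theorem rpow_mul_add_rpow_mul_ge {β u v : ℝ} (hβ : 0 ≤ β) (hu : 0 < u) (hv : 0 < v) :
    ((u + v) / 2) ^ β * (u * v / (u + v)) ≤ u ^ β * v + v ^ β * u := by
  wlog h : u ≤ v generalizing u v
  · have := this hv hu (le_of_not_ge h)
    rw [add_comm v u, mul_comm v u] at this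
    linarith
  have h1 : ((u + v) / 2) ^ β ≤ v ^ β :=
    Real.rpow_le_rpow (by positivity) (by linarith) hβ
  have h2 : u * v / (u + v) ≤ u := by
    rw [div_le_iff₀ (by positivity)]; nlinarith
  have h3 : 0 ≤ u ^ β * v := by positivity
  calc _ ≤ v ^ β * u := by gcongr
    _ ≤ _ := by linarith

/-- The reflection `k ↦ n - 1 - k` swaps `k + 1` and `n - k`, whose sum `n + 1` is constant.
Averaging the sum with its reflection thus replaces the power by `(n/2)^β`, and the remaining sum of
products is explicit. -/
theorem sum_rpow_mul_sub_ge {β : ℝ} (hβ : 0 ≤ β) {n : ℕ} (hn : 1 ≤ n) :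
    2 ^ (-β) / 12 * (n : ℝ) ^ (β + 2) ≤
      ∑ k ∈ Finset.range n, ((k : ℝ) + 1) ^ β * ((n : ℝ) - k) := by
  have hn0 : (0 : ℝ) < n := by exact_mod_cast hn
  set S := ∑ k ∈ Finset.range n, ((k : ℝ) + 1) ^ β * ((n : ℝ) - k) with hS
  have hrefl : S = ∑ k ∈ Finset.range n, ((n : ℝ) - k) ^ β * ((k : ℝ) + 1) := by
    rw [hS, ← Finset.sum_range_reflect]
    refine Finset.sum_congr rfl fun k hk => ?_
    rw [Finset.mem_range] at hk
    rw [Nat.sub_sub, Nat.cast_sub (by omega)]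
    push_cast
    congr 2 <;> ring
  have h2S : ∑ k ∈ Finset.range n, ((n : ℝ) / 2) ^ β / (n + 1) * (((k : ℝ) + 1) * (n - k)) ≤
      S + S := by
    nth_rewrite 2 [hrefl]
    rw [hS, ← Finset.sum_add_distrib]
    refine Finset.sum_le_sum fun k hk => ?_
    have hk : (k : ℝ) < n := by exact_mod_cast Finset.mem_range.1 hk
    refine le_trans ?_ (rpow_mul_add_rpow_mul_ge hβ (u := (k : ℝ) + 1) (v := n - k)
      (by positivity) (by linarith))
    rw [show (k : ℝ) + 1 + (n - k) = n + 1 by ring, div_mul_eq_mul_div, mul_div_assoc]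
    have : 0 ≤ (n : ℝ) - k := by linarith
    gcongr
    linarith
  rw [← Finset.mul_sum, sum_succ_mul_sub] at h2S
  have e : ((n : ℝ) / 2) ^ β / (n + 1) * (n * n * (n + 1) / 2 - (n - 1) * n * (n + 1) / 3) =
      ((n : ℝ) / 2) ^ β * n * (n + 2) / 6 := by
    field_simp; ring
  have e2 : 2 ^ (-β) * (n : ℝ) ^ (β + 2) = ((n : ℝ) / 2) ^ β * n * n := by
    rw [Real.div_rpow hn0.le (by norm_num), Real.rpow_neg (by norm_num), Real.rpow_add hn0]
    rw [Real.rpow_two]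
    field_simp
  rw [e] at h2S
  have h3 : 0 ≤ ((n : ℝ) / 2) ^ β * n := by positivity
  rw [div_mul_eq_mul_div, e2]
  nlinarith

/-- The test polynomial `ε ∑_{k < n} (k + 1) ^ β X ^ k`. -/
noncomputable def testPoly (n : ℕ) (β ε : ℝ) : Polynomial ℂ :=
  ∑ k ∈ Finset.range n, Polynomial.monomial k ((ε * ((k : ℝ) + 1) ^ β : ℝ) : ℂ)

theorem testPoly_coeff (n : ℕ) (β ε : ℝ) (k : ℕ) :
    (testPoly n β ε).coeff k = if k < n then ((ε * ((k : ℝ) + 1) ^ β : ℝ) : ℂ) else 0 := by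
  simp only [testPoly, Polynomial.finsetSum_coeff, Polynomial.coeff_monomial, Finset.sum_ite_eq',
    Finset.mem_range]

theorem norm_taylorCoeff_testPoly_mul {n : ℕ} {α ε : ℝ} (hε : 0 ≤ ε) (k : ℕ) :
    ‖taylorCoeff (fun z => (testPoly n (-α) ε).eval z) k‖ * ((k : ℝ) + 1) ^ α =
      if k < n then ε else 0 := by
  have hk : (0 : ℝ) < k + 1 := by positivity
  rw [taylorCoeff_polynomial_eval, testPoly_coeff]
  split_ifs
  · rw [norm_real, Real.norm_of_nonneg (by positivity), mul_assoc, ← Real.rpow_add hk]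
    simp
  · simp

/-- The weights cancel, leaving `n` terms all equal to `n^(-1/p)`. -/
theorem lapNorm_testPoly_le_one {p : ℝ≥0∞} (hp : 2 ≤ p) (α : ℝ) {n : ℕ} (hn : 1 ≤ n) :
    lapNorm p α (fun z => (testPoly n (-α) ((n : ℝ) ^ (-p⁻¹.toReal))).eval z) ≤ 1 := by
  have hn0 : (0 : ℝ) < n := by exact_mod_cast hn
  have hε : 0 ≤ (n : ℝ) ^ (-p⁻¹.toReal) := by positivity
  by_cases hp' : p = ∞
  · subst hp'
    rw [lapNorm, if_pos rfl]
    refine iSup_le fun k => ?_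
    rw [norm_taylorCoeff_testPoly_mul hε]
    split_ifs <;> simp
  · have hq : 0 < p.toReal := ENNReal.toReal_pos (by rintro rfl; simp at hp) hp'
    rw [lapNorm, if_neg hp', one_div, ENNReal.rpow_inv_le_iff hq, ENNReal.one_rpow]
    have hterm : ∀ k : ℕ, ENNReal.ofReal
        (‖taylorCoeff (fun z => (testPoly n (-α) ((n : ℝ) ^ (-p⁻¹.toReal))).eval z) k‖ ^ p.toReal *
          ((k : ℝ) + 1) ^ (p.toReal * α)) = if k < n then (n : ℝ≥0∞)⁻¹ else 0 := by
      intro k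
      rw [mul_comm p.toReal α, Real.rpow_mul (by positivity), ← Real.mul_rpow (by positivity)
        (by positivity), norm_taylorCoeff_testPoly_mul hε]
      split_ifs
      · rw [← Real.rpow_mul hn0.le, ENNReal.toReal_inv, neg_mul, inv_mul_cancel₀ hq.ne',
          Real.rpow_neg_one, ENNReal.ofReal_inv_of_pos hn0, ENNReal.ofReal_natCast]
      · simp [hq.ne']
    simp only [hterm]
    rw [tsum_eq_sum (s := Finset.range n) fun k hk => if_neg (by simpa using hk)]
    rw [Finset.sum_congr rfl fun k hk => if_pos (Finset.mem_range.1 hk)]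
    simp only [Finset.sum_const, Finset.card_range, nsmul_eq_mul]
    exact ENNReal.mul_inv_le_one _

theorem norm_le_toReal_hInftyNorm {g : ℂ → ℂ} (h : hInftyNorm g ≠ ∞) {z : ℂ} (hz : z ∈ disc) :
    ‖g z‖ ≤ (hInftyNorm g).toReal := by
  rw [← ENNReal.ofReal_le_iff_le_toReal h]
  exact le_iSup₂ (f := fun z (_ : z ∈ disc) => ENNReal.ofReal ‖g z‖) z hz

theorem le_worstInterpConst {p : ℝ≥0∞} (hp : 2 ≤ p) {α : ℝ} (hα : α ≤ 0) {n : ℕ} (hn : 1 ≤ n)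
    {r : ℝ} (hr : 0 ≤ r) :
    ENNReal.ofReal (2 ^ α / 24 * (n : ℝ) ^ (1 - α - p⁻¹.toReal)) ≤
      worstInterpConst n r (lapNorm p α) hInftyNorm := by
  have hn0 : (0 : ℝ) < n := by exact_mod_cast hn
  set A := testPoly n (-α) ((n : ℝ) ^ (-p⁻¹.toReal)) with hA
  have hσ : (Multiset.replicate n (0 : ℂ)).card ≤ n ∧
      ∀ μ ∈ Multiset.replicate n (0 : ℂ), ‖μ‖ ≤ r :=
    ⟨by simp, fun μ hμ => by rw [Multiset.eq_of_mem_replicate hμ]; simpa⟩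
  refine le_trans ?_ (le_iSup₂ (f := fun (σ : Multiset ℂ) (_ : σ.card ≤ n ∧ ∀ μ ∈ σ, ‖μ‖ ≤ r) =>
    interpConst σ (lapNorm p α) hInftyNorm) (Multiset.replicate n 0) hσ)
  have hf : DifferentiableOn ℂ (fun z => A.eval z) disc ∧ lapNorm p α (fun z => A.eval z) ≤ 1 :=
    ⟨A.differentiable.differentiableOn, lapNorm_testPoly_le_one hp α hn⟩
  refine le_trans ?_ (le_iSup₂ (f := fun (f : ℂ → ℂ)
    (_ : DifferentiableOn ℂ f disc ∧ lapNorm p α f ≤ 1) => ⨅ (g : ℂ → ℂ)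
      (_ : DifferentiableOn ℂ g disc ∧ SameTrace (Multiset.replicate n 0) f g), hInftyNorm g)
    (fun z => A.eval z) hf)
  refine le_iInf₂ fun g hg => ?_
  -- An infinite norm is treated apart, because `toReal` would turn it into `0`.
  by_cases htop : hInftyNorm g = ∞
  · rw [htop]; exact le_top
  rw [ENNReal.ofReal_le_iff_le_toReal htop]
  obtain ⟨m, rfl⟩ : ∃ m, n = m + 1 := ⟨n - 1, by omega⟩
  have h := norm_sum_coeff_le_of_sameTrace hg.1 hg.2 fun z hz => norm_le_toReal_hInftyNorm htop hz
  set n : ℕ := m + 1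
  set ε : ℝ := (n : ℝ) ^ (-p⁻¹.toReal) with hε
  have hsum : ∑ k ∈ Finset.range n, A.coeff k * ((n : ℂ) - k) =
      ((ε * ∑ k ∈ Finset.range n, ((k : ℝ) + 1) ^ (-α) * ((n : ℝ) - k) : ℝ) : ℂ) := by
    rw [Finset.mul_sum, Complex.ofReal_sum]
    refine Finset.sum_congr rfl fun k hk => ?_
    rw [hA, testPoly_coeff, if_pos (Finset.mem_range.1 hk)]
    push_cast
    ring
  rw [hsum, norm_real] at h
  have h1 := (le_abs_self _).trans h
  have h2 := sum_rpow_mul_sub_ge (β := -α) (by linarith) hn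
  rw [neg_neg] at h2
  have h3 : ε * (2 ^ α / 12 * (n : ℝ) ^ (-α + 2)) ≤ 2 * (hInftyNorm g).toReal * n :=
    le_trans (by gcongr) h1
  have e : ε * (n : ℝ) ^ (-α + 2) = (n : ℝ) ^ (1 - α - p⁻¹.toReal) * n := by
    rw [hε, ← Real.rpow_add hn0]
    nth_rewrite 3 [← Real.rpow_one (n : ℝ)]
    rw [← Real.rpow_add hn0]
    congr 1; ring
  have h4 : 2 ^ α / 24 * (n : ℝ) ^ (1 - α - p⁻¹.toReal) * n ≤ (hInftyNorm g).toReal * n := by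
    linear_combination h3 / 2 - (2 ^ α / 24) * e
  exact le_of_mul_le_mul_right h4 hn0

theorem exists_worstInterpConst_le {p : ℝ≥0∞} (hp : 2 ≤ p) {α : ℝ} (hα : α ≤ 0) :
    ∃ C : ℝ, 0 < C ∧ ∀ (n : ℕ) (r : ℝ), 1 ≤ n → 0 ≤ r → r < 1 →
      worstInterpConst n r (lapNorm p α) hInftyNorm ≤
        ENNReal.ofReal (C * ((n : ℝ) / (1 - r)) ^ (1 - α - p⁻¹.toReal)) := by
  obtain ⟨C, hC, h⟩ := exists_bounded_interpolant hp hα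
  refine ⟨C, hC, fun n r hn h0 hr => iSup₂_le fun σ hσ => iSup₂_le fun f hf => ?_⟩
  obtain ⟨G, hGd, hGt, hG⟩ := h n r hn h0 hr σ hσ.1 hσ.2 f hf.1 hf.2
  exact iInf₂_le_of_le G ⟨hGd, hGt⟩ (iSup₂_le fun z hz => ENNReal.ofReal_le_ofReal (hG z hz))

end ConstrainedInterpolation

theorem theoremD (p : ENNReal) (hp : 2 ≤ p) (α : ℝ) (hα : α ≤ 0) :
    ∃ A' B' : ℝ, 0 < A' ∧ 0 < B' ∧
      ∀ (n : ℕ) (r : ℝ), 1 ≤ n → 0 ≤ r → r < 1 →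
        ENNReal.ofReal (B' * (n : ℝ) ^ (1 - α - p⁻¹.toReal)) ≤
            ConstrainedInterpolation.worstInterpConst n r
              (ConstrainedInterpolation.lapNorm p α) ConstrainedInterpolation.hInftyNorm ∧
          ConstrainedInterpolation.worstInterpConst n r
              (ConstrainedInterpolation.lapNorm p α) ConstrainedInterpolation.hInftyNorm ≤
            ENNReal.ofReal (A' * ((n : ℝ) / (1 - r)) ^ (3 / 2 - α - 2 * p⁻¹.toReal)) := by
  obtain ⟨C, hC, hCb⟩ := ConstrainedInterpolation.exists_worstInterpConst_le hp hα
  refine ⟨C, 2 ^ α / 24, hC, by positivity, fun n r hn h0 hr =>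
    ⟨ConstrainedInterpolation.le_worstInterpConst hp hα hn h0, (hCb n r hn h0 hr).trans ?_⟩⟩
  have hn' : (1 : ℝ) ≤ n := by exact_mod_cast hn
  have hN : 1 ≤ (n : ℝ) / (1 - r) := by
    rw [le_div_iff₀ (by linarith)]; linarith
  -- This is where the sharper exponent `1 - α - 1/p` is compared with `3/2 - α - 2/p`.
  have hp2 : p⁻¹.toReal ≤ 1 / 2 := by
    have := ENNReal.toReal_mono (by simp) (ENNReal.inv_le_inv.2 hp)
    simpa using this
  apply ENNReal.ofReal_le_ofReal
  refine mul_le_mul_of_nonneg_left (Real.rpow_le_rpow_of_exponent_le hN ?_) hC.le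
  linarith
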